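/- All groups are finite and all characters are complex. Let $G$ be a finite group and $N$ a normal subgroup of $G$. For $\theta\in\mathrm{Irr}(N)$ let $\widehat\theta$ be the sum of the distinct $G$-conjugates of $\theta$, where $\theta^g(n)=\theta(gng^{-1})$, and for a character $\chi$ let $\ker(\chi)=\{x : \chi(x)=\chi(1)\}$. For a subgroup $H\le G$ and $\theta\in\mathrm{Irr}(H)$ let $\mathrm{Irr}(G|\theta)$ be the set of $\chi\in\mathrm{Irr}(G)$ whose restriction to $H$ has $\theta$ as a constituent. Let $\mathrm{Lcd}_G(N)=\{\theta(1)\widehat\theta(1) : \theta\in\mathrm{Irr}(N)\}$ be the set of degrees of the leader $G$-characters $\theta\widehat\theta$ of $N$. Let $\Gamma_G^1(N)=N$ and $\Gamma_G^{r+1}(N)=[\Gamma_G^r(N),G]$ for $r\ge 1$; $N$ is hypercentral in $G$ if $\Gamma_G^r(N)=1$ for some $r\ge1$, and then its hypercentral $G$-length $\mathbf{l}_G(N)$ is the least $k\ge 0$ with $\Gamma_G^{k+1}(N)=1$. Suppose that $N$ is a $G$-invariant $nMI$-subgroup of $G$: for every $\theta\in\mathrm{Irr}(N)$ there are a normal subgroup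 $H$ of $G$ with $H\le N$ and a linear $G$-invariant character $\lambda$ of $H$ such that $\mathrm{Irr}(G|\theta)=\mathrm{Irr}(G|\lambda)$. Let $f_1<f_2<\dots<f_s$ be the distinct elements of $\mathrm{Lcd}_G(N)$; these are positive integers, $s\ge 1$ and $f_1=1$. Then for every $i\in\{1,\dots,s\}$ and every $\theta\in\mathrm{Irr}(N)$ with $\theta(1)\widehat\theta(1)=f_i$, $$\Gamma_G^{i+1}(N)\subseteq\ker(\widehat\theta).$$ In particular, $N$ is hypercentral in $G$ and $\mathbf{l}_G(N)\le s=|\mathrm{Lcd}_G(N)|$. -/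

import Mathlib

noncomputable section

namespace GChar

/-- `Irr(G)`: the irreducible complex characters of `G`, as functions on `G`.  Every
finite-dimensional complex representation is isomorphic to one on some `ℂⁿ`, so it is enough to
let the representation space be `Fin n → ℂ`. -/
def Irr (G : Type*) [Group G] : Set (G → ℂ) :=
  {χ | ∃ (n : ℕ) (ρ : Representation ℂ G (Fin n → ℂ)), ρ.IsIrreducible ∧ ρ.character = χ}

/-- The inner product `[φ, ψ] = |G|⁻¹ ∑ φ(g) ψ(g⁻¹)` of two characters of a finite group
(recall that `ψ(g⁻¹)` is the complex conjugate of `ψ(g)` when `ψ` is a character). -/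
def charInner {G : Type*} [Group G] (φ ψ : G → ℂ) : ℂ :=
  (Nat.card G : ℂ)⁻¹ * ∑ᶠ g : G, φ g * ψ g⁻¹

/-- The kernel `{g | χ(g) = χ(1)}` of a character `χ`. -/
def charKer {G : Type*} [Group G] (χ : G → ℂ) : Set G :=
  {g | χ g = χ 1}

variable {G : Type*} [Group G]

/-- `Irr(G|θ)`: the irreducible characters `χ` of `G` whose restriction to the subgroup `H`
has `θ` as a constituent. -/
def IrrOver (H : Subgroup G) (θ : H → ℂ) : Set (G → ℂ) :=
  {χ | χ ∈ Irr G ∧ charInner (fun h : H => χ h) θ ≠ 0}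

/-- The conjugate `θ^g`, `θ^g(n) = θ(g n g⁻¹)`, of a function `θ` on a normal subgroup `N`. -/
def conjChar (N : Subgroup G) [N.Normal] (g : G) (θ : N → ℂ) : N → ℂ :=
  fun n => θ (MulAut.conjNormal g n)

/-- `θ̂`: the sum of the distinct `G`-conjugates of `θ`. -/
def hat [Finite G] (N : Subgroup G) [N.Normal] (θ : N → ℂ) : N → ℂ :=
  ∑ φ ∈ (Set.finite_range fun g : G => conjChar N g θ).toFinset, φ

/-- `Lin_G(N)`: the linear `G`-invariant (irreducible) characters of `N`. -/
def LinG (N : Subgroup G) [N.Normal] : Set (N → ℂ) :=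
  {θ | θ ∈ Irr N ∧ θ 1 = 1 ∧ ∀ g : G, conjChar N g θ = θ}

/-- `(H, l)` is a linear `G`-character pair with respect to the character `θ` of `N`. -/
def IsLinearGPair (N : Subgroup G) (θ : N → ℂ) (H : Subgroup G) [H.Normal] (l : H → ℂ) : Prop :=
  H ≤ N ∧ l ∈ LinG H ∧ IrrOver N θ = IrrOver H l

/-- The normal subgroup `N` is a `G`-invariant `nMI`-subgroup of `G`. -/
def IsNMISubgroup (N : Subgroup G) : Prop :=
  ∀ θ ∈ Irr N, ∃ (H : Subgroup G) (_ : H.Normal) (l : H → ℂ), IsLinearGPair N θ H l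

/-- `Lcd_G(N)`: the set of degrees `θ(1) θ̂(1)` of the leader `G`-characters `θ θ̂` of `N`. -/
def Lcd [Finite G] (N : Subgroup G) [N.Normal] : Set ℂ :=
  {d | ∃ θ ∈ Irr N, θ 1 * hat N θ 1 = d}

/-- `f 1 < f 2 < ⋯ < f s` are the distinct elements of `Lcd_G(N)`. -/
def EnumeratesLcd [Finite G] (N : Subgroup G) [N.Normal] (s : ℕ) (f : ℕ → ℕ) : Prop :=
  StrictMonoOn f (Set.Icc 1 s) ∧ (fun i => (f i : ℂ)) '' Set.Icc 1 s = Lcd N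

/-- The lower central `G`-series of `N`, indexed from `1`: `Γ¹ = N` and `Γ^{r+1} = [Γ^r, G]`.
The value at index `0` is a convention. -/
def lowerGSeries (N : Subgroup G) : ℕ → Subgroup G
  | 0 => N
  | 1 => N
  | r + 2 => ⁅lowerGSeries N (r + 1), (⊤ : Subgroup G)⁆

/-- `N` is a hypercentral subgroup of `G`. -/
def IsHypercentral (N : Subgroup G) : Prop :=
  ∃ r : ℕ, 1 ≤ r ∧ lowerGSeries N r = ⊥

/-- The hypercentral `G`-length of a hypercentral subgroup `N`: the least `k` such that
`Γ^{k+1} = 1`. -/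
def hypercentralLength (N : Subgroup G) : ℕ :=
  sInf {k : ℕ | lowerGSeries N (k + 1) = ⊥}

end GChar

end

/-!
Let `(H, l)` be a linear `G`-character pair for `θ ∈ Irr(N)`.  Since `Irr(G|θ) = Irr(G|l)`,
Clifford's theorem shows that the irreducible characters of `N` lying over `l` are exactly the
conjugates of `θ` (`IsLinearGPair.irrLiesOver_eq`).  As `l` is linear and `G`-invariant, each of
them restricts to a multiple of `l` (`LiesOver.apply_eq`), and averaging the regular character of
`N` against `l` gives `∑ φ(1)² = |N : H|` over them (`card_mul_sum_irrLiesOver`); this sum is the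
degree `θ(1) θ̂(1)` of the leader character.

The same formula for the trivial character of `H` shows that the irreducible characters of `N / H`
also have squared degrees adding up to `|N : H|`.  So a non-trivial one has a conjugacy class
missing the trivial character, and its leader degree is strictly smaller than that of `θ`
(`IsLinearGPair.mul_hat_apply_one_lt`).  By induction on the index `i` of the leader degree, `Γ^i`
lies in the kernels of all irreducible characters of `N / H`, that is, in `H`
(`mem_of_forall_apply_eq`).  Hence `Γ^{i+1} ≤ [H, G]`, on which `l`, and with it every conjugate of
`θ`, is trivial (`apply_eq_of_mem_lowerGSeries`).  Finally, irreducible characters separate the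
identity of `N`, so `Γ^{s+1} = 1`.

Clifford's theorem and the behaviour of averages over `H` both come from one form of Schur's lemma,
`exists_convolution_eq`: an invariant weighted sum of group elements acts on an irreducible
representation as a scalar.
-/

noncomputable section

open Representation

namespace GChar

/-! ### Irreducible representations and their characters -/

section Irreducibles

theorem isIrreducible_iff {K V : Type*} [Group K] [AddCommGroup V] [Module ℂ V]
    (ρ : Representation ℂ K V) :
    ρ.IsIrreducible ↔ Nontrivial V ∧
      ∀ p : Submodule ℂ V, (∀ g, ∀ v ∈ p, ρ g v ∈ p) → p = ⊥ ∨ p = ⊤ := by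
  constructor
  · intro h
    refine ⟨?_, fun p hp => ?_⟩
    · by_contra hV
      rw [not_nontrivial_iff_subsingleton] at hV
      obtain ⟨a, b, hab⟩ := h.exists_pair_ne
      refine hab (Subrepresentation.toSubmodule_injective ?_)
      ext v
      simp [Subsingleton.elim v 0]
    · rcases h.eq_bot_or_eq_top ⟨p, fun g v hv => hp g v hv⟩ with h | h
      · exact .inl (congrArg Subrepresentation.toSubmodule h)
      · exact .inr (congrArg Subrepresentation.toSubmodule h)
  · rintro ⟨hV, h⟩
    have hne : (⊥ : Subrepresentation ρ) ≠ ⊤ := fun hbt =>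
      bot_ne_top (α := Submodule ℂ V) (congrArg Subrepresentation.toSubmodule hbt)
    exact
      { exists_pair_ne := ⟨_, _, hne⟩
        eq_bot_or_eq_top := fun σ => by
          rcases h σ.toSubmodule (fun g v hv => σ.apply_mem_toSubmodule g hv) with h | h
          · exact .inl (Subrepresentation.toSubmodule_injective h)
          · exact .inr (Subrepresentation.toSubmodule_injective h) }

/-- Irreducibility passes along a linear equivalence that carries every operator of the first
group to an operator of the second one.  Covers both isomorphic representations and pullbacks
along surjective homomorphisms. -/
theorem isIrreducible_of_linearEquiv {K L V W : Type*} [Group K] [Group L] [AddCommGroup V] [Module ℂ V]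
    [AddCommGroup W] [Module ℂ W] {ρ : Representation ℂ K V} {σ : Representation ℂ L W}
    (hρ : ρ.IsIrreducible) (e : V ≃ₗ[ℂ] W) (h : ∀ g, ∃ k, ∀ v, e (ρ g v) = σ k (e v)) :
    σ.IsIrreducible := by
  rw [isIrreducible_iff] at hρ ⊢
  obtain ⟨hV, hρ⟩ := hρ
  refine ⟨e.symm.toEquiv.nontrivial, fun p hp => ?_⟩
  have hp' : ∀ g, ∀ v ∈ p.comap e.toLinearMap, ρ g v ∈ p.comap e.toLinearMap := by
    intro g v hv
    obtain ⟨k, hk⟩ := h g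
    simpa [hk] using hp k _ hv
  refine (hρ _ hp').imp (fun hb => ?_) (fun ht => ?_)
  · rw [Submodule.eq_bot_iff] at hb ⊢
    intro w hw
    simpa using hb (e.symm w) (by simpa using hw)
  · rw [Submodule.eq_top_iff'] at ht ⊢
    intro w
    simpa using ht (e.symm w)

theorem character_mem_irr {K V : Type*} [Group K] [AddCommGroup V] [Module ℂ V]
    [FiniteDimensional ℂ V] {ρ : Representation ℂ K V} (hρ : ρ.IsIrreducible) :
    ρ.character ∈ Irr K := by
  let e : V ≃ₗ[ℂ] (Fin (Module.finrank ℂ V) → ℂ) := (Module.finBasis ℂ V).equivFun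
  let σ : Representation ℂ K (Fin (Module.finrank ℂ V) → ℂ) :=
    (e.conjAlgEquiv ℂ : Module.End ℂ V →* Module.End ℂ _).comp ρ
  have hσ : ∀ g, σ g = e.conj (ρ g) := fun _ => rfl
  refine ⟨_, σ, isIrreducible_of_linearEquiv hρ e fun g => ⟨g, fun v => ?_⟩, ?_⟩
  · simp [hσ, LinearEquiv.conj_apply]
  · ext g
    simp only [character, hσ]
    exact LinearMap.trace_conj' _ _

theorem comp_mem_irr {K L : Type*} [Group K] [Group L] {χ : L → ℂ} (hχ : χ ∈ Irr L)
    (f : K →* L) (hf : Function.Surjective f) : χ ∘ f ∈ Irr K := by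
  obtain ⟨n, ρ, hρ, rfl⟩ := hχ
  refine ⟨n, ρ.comp f, isIrreducible_of_linearEquiv hρ (.refl ℂ _) fun g => ?_, rfl⟩
  obtain ⟨k, rfl⟩ := hf g
  exact ⟨k, fun v => rfl⟩

theorem one_mem_irr {K : Type*} [Group K] : (1 : K → ℂ) ∈ Irr K := by
  refine ⟨1, 1, ?_, ?_⟩
  · rw [isIrreducible_iff]
    refine ⟨inferInstance, fun p _ => ?_⟩
    have : IsSimpleModule ℂ (Fin 1 → ℂ) := by
      rw [isSimpleModule_iff_finrank_eq_one]; simp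
    exact eq_bot_or_eq_top p
  · ext g
    simp [character]

theorem irr_apply_one {K : Type*} [Group K] {χ : K → ℂ} (hχ : χ ∈ Irr K) :
    ∃ n : ℕ, 0 < n ∧ χ 1 = n := by
  obtain ⟨n, ρ, hρ, rfl⟩ := hχ
  refine ⟨n, Nat.pos_of_ne_zero ?_, by simp⟩
  rintro rfl
  have := ((isIrreducible_iff ρ).1 hρ).1
  exact not_nontrivial _ this

theorem irr_apply_one_ne_zero {K : Type*} [Group K] {χ : K → ℂ} (hχ : χ ∈ Irr K) : χ 1 ≠ 0 := by
  obtain ⟨n, hn, h⟩ := irr_apply_one hχ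
  rw [h]
  exact_mod_cast hn.ne'

/-- The trace on a one-dimensional space is multiplicative. -/
theorem linear_map_mul {K : Type*} [Group K] {χ : K → ℂ} (hχ : χ ∈ Irr K) (h1 : χ 1 = 1)
    (g h : K) : χ (g * h) = χ g * χ h := by
  obtain ⟨n, ρ, hρ, rfl⟩ := hχ
  obtain rfl : n = 1 := by simpa using h1
  simp only [character, map_mul]
  simp only [LinearMap.trace_eq_matrix_trace ℂ (Pi.basisFun ℂ (Fin 1)), LinearMap.toMatrix_mul,
    Matrix.trace_fin_one, Matrix.mul_apply, Fin.sum_univ_one]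

end Irreducibles

/-! ### Complete reducibility -/

section Decomposition

variable {K : Type*} [Group K] [Finite K]

/-- Complete reducibility: every character of a finite group is a finite sum of irreducible
characters. -/
theorem exists_sum_irr {V : Type*} [AddCommGroup V] [Module ℂ V] [FiniteDimensional ℂ V]
    (ρ : Representation ℂ K V) :
    ∃ (ι : Type) (_ : Fintype ι) (ψ : ι → K → ℂ), (∀ i, ψ i ∈ Irr K) ∧
      ρ.character = ∑ i, ψ i := by
  induction hd : Module.finrank ℂ V using Nat.strong_induction_on generalizing V with
  | _ d ih =>
  by_cases hirr : ρ.IsIrreducible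
  · exact ⟨Unit, inferInstance, fun _ => ρ.character, fun _ => character_mem_irr hirr, by simp⟩
  rcases subsingleton_or_nontrivial V with hV | hV
  · refine ⟨Empty, inferInstance, nofun, nofun, ?_⟩
    ext g
    simp [character, Subsingleton.elim (ρ g) 0]
  -- A proper non-zero subrepresentation has a complement, and traces are additive.
  obtain ⟨p, hp, hp0, hp1⟩ : ∃ p : Submodule ℂ V, (∀ g, ∀ v ∈ p, ρ g v ∈ p) ∧ p ≠ ⊥ ∧ p ≠ ⊤ := by
    rw [isIrreducible_iff] at hirr
    push Not at hirr
    exact hirr hV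
  have hss : IsSemisimpleRepresentation ρ := by
    rw [isSemisimpleRepresentation_iff_isSemisimpleModule_asModule]
    have : NeZero (Nat.card K : ℂ) := ⟨by exact_mod_cast Nat.card_pos.ne'⟩
    infer_instance
  let P : Subrepresentation ρ := ⟨p, fun g v hv => hp g v hv⟩
  obtain ⟨Q, hPQ⟩ := exists_isCompl P
  have hc : IsCompl P.toSubmodule Q.toSubmodule := by
    refine ⟨?_, ?_⟩
    · rw [disjoint_iff]
      exact congrArg Subrepresentation.toSubmodule hPQ.1.eq_bot
    · rw [codisjoint_iff]
      exact congrArg Subrepresentation.toSubmodule hPQ.2.eq_top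
  have hsum := Submodule.finrank_add_eq_of_isCompl hc
  have hPpos : 0 < Module.finrank ℂ P.toSubmodule := by
    have := (Submodule.finrank_eq_zero (S := p)).not.2 hp0
    exact Nat.pos_of_ne_zero this
  have hPlt : Module.finrank ℂ P.toSubmodule < d := hd ▸ Submodule.finrank_lt hp1
  obtain ⟨ι, _, ψ, hψ, h1⟩ := ih _ hPlt P.toRepresentation rfl
  obtain ⟨κ, _, φ, hφ, h2⟩ := ih _ (by omega) Q.toRepresentation rfl
  refine ⟨ι ⊕ κ, inferInstance, Sum.elim ψ φ, by rintro (i | i) <;> simp [hψ, hφ], ?_⟩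
  have : ρ.character = P.toRepresentation.character + Q.toRepresentation.character := by
    rw [char_iso (σ := P.toRepresentation.prod Q.toRepresentation)
      (Representation.Equiv.mk (Submodule.prodEquivOfIsCompl _ _ hc) fun g => ?_).symm]
    · ext g
      exact LinearMap.trace_prodMap' _ _
    · ext v <;> simp [Subrepresentation.toRepresentation]
  rw [this, h1, h2]
  simp

theorem exists_sum_irr_of_comp {L : Type*} [Group L] {χ : L → ℂ} (hχ : χ ∈ Irr L) (f : K →* L) :
    ∃ (ι : Type) (_ : Fintype ι) (ψ : ι → K → ℂ), (∀ i, ψ i ∈ Irr K) ∧ χ ∘ f = ∑ i, ψ i := by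
  obtain ⟨n, ρ, hρ, rfl⟩ := hχ
  exact exists_sum_irr (ρ.comp f)

end Decomposition

/-! ### Orthogonality of irreducible characters -/

section InnerProduct

variable {K : Type*} [Group K]

theorem charInner_eq_sum [Fintype K] (φ ψ : K → ℂ) :
    charInner φ ψ = (Nat.card K : ℂ)⁻¹ * ∑ g : K, φ g * ψ g⁻¹ := by
  rw [charInner, finsum_eq_sum_of_fintype]

theorem card_mul_charInner [Fintype K] (φ ψ : K → ℂ) :
    (Nat.card K : ℂ) * charInner φ ψ = ∑ g : K, φ g * ψ g⁻¹ := by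
  rw [charInner_eq_sum, mul_inv_cancel_left₀]
  exact_mod_cast Nat.card_pos.ne'

variable [Finite K]

theorem charInner_sum_left {ι : Type*} (s : Finset ι) (φ : ι → K → ℂ) (ψ : K → ℂ) :
    charInner (∑ i ∈ s, φ i) ψ = ∑ i ∈ s, charInner (φ i) ψ := by
  have := Fintype.ofFinite K
  simp only [charInner_eq_sum, ← Finset.mul_sum, Finset.sum_apply, Finset.sum_mul]
  rw [Finset.sum_comm]

theorem charInner_sum_right {ι : Type*} (s : Finset ι) (φ : ι → K → ℂ) (ψ : K → ℂ) :
    charInner ψ (∑ i ∈ s, φ i) = ∑ i ∈ s, charInner ψ (φ i) := by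
  have := Fintype.ofFinite K
  simp only [charInner_eq_sum, ← Finset.mul_sum, Finset.sum_apply]
  simp only [Finset.mul_sum]
  rw [Finset.sum_comm]

theorem charInner_smul_left (c : ℂ) (φ ψ : K → ℂ) :
    charInner (c • φ) ψ = c * charInner φ ψ := by
  have := Fintype.ofFinite K
  simp only [charInner_eq_sum, Pi.smul_apply, smul_eq_mul, mul_assoc, ← Finset.mul_sum]
  ring

open Classical in
/-- The first orthogonality relation. -/
theorem charInner_irr {φ ψ : K → ℂ} (hφ : φ ∈ Irr K) (hψ : ψ ∈ Irr K) :
    charInner φ ψ = if φ = ψ then 1 else 0 := by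
  have := Fintype.ofFinite K
  have : Invertible (Nat.card K : ℂ) := invertibleOfNonzero (by exact_mod_cast Nat.card_pos.ne')
  obtain ⟨n, ρ, hρ, rfl⟩ := hφ
  obtain ⟨m, σ, hσ, rfl⟩ := hψ
  rw [charInner_eq_sum]
  split_ifs with h
  · rw [← h, char_orthonormal, if_pos ⟨Representation.Equiv.refl ρ⟩]
  · rw [char_orthonormal, if_neg]
    rintro ⟨e⟩
    exact h (char_iso e).symm

/-- Multiplicities are natural numbers. -/
theorem charInner_comp_irr_nat {L : Type*} [Group L] {χ : L → ℂ} (hχ : χ ∈ Irr L) (f : K →* L)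
    {φ : K → ℂ} (hφ : φ ∈ Irr K) : ∃ n : ℕ, charInner (χ ∘ f) φ = n := by
  classical
  obtain ⟨ι, _, ψ, hψ, h⟩ := exists_sum_irr_of_comp hχ f
  refine ⟨(Finset.univ.filter fun i => ψ i = φ).card, ?_⟩
  rw [h, charInner_sum_left]
  simp [charInner_irr (hψ _) hφ]

end InnerProduct

/-! ### Schur's lemma -/

section Schur

/-- Schur's lemma for characters: a weighted sum of group elements `∑ f i • j i` that is invariant
under conjugation acts on an irreducible representation as a scalar `c`, so that convolution with
it multiplies the character by `c`. -/
theorem exists_convolution_eq {K ι : Type*} [Group K] [Fintype ι] {χ : K → ℂ} (hχ : χ ∈ Irr K)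
    (j : ι → K) (f : ι → ℂ)
    (hinv : ∀ g : K, ∃ σ : Equiv.Perm ι, ∀ i, j (σ i) = g * j i * g⁻¹ ∧ f (σ i) = f i) :
    ∃ c : ℂ, ∀ g, ∑ i, f i * χ (j i * g) = c * χ g := by
  obtain ⟨n, ρ, hρ, rfl⟩ := hχ
  let T : Module.End ℂ (Fin n → ℂ) := ∑ i, f i • ρ (j i)
  have hT : ∀ g, T * ρ g = ρ g * T := by
    intro g
    obtain ⟨σ, hσ⟩ := hinv g
    calc T * ρ g = (∑ i, f (σ i) • ρ (j (σ i))) * ρ g := by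
          rw [Equiv.sum_comp σ (fun i => f i • ρ (j i))]
      _ = ρ g * T := by
          simp only [T, Finset.sum_mul, Finset.mul_sum, hσ, smul_mul_assoc, mul_smul_comm,
            ← map_mul, inv_mul_cancel_right]
  obtain ⟨c, hc⟩ := (IsIrreducible.algebraMap_intertwiningMap_bijective_of_isAlgClosed
    (ρ := ρ)).2 ⟨T, fun g => hT g⟩
  have hTc : T = c • 1 := by
    have := congrArg IntertwiningMap.toLinearMap hc
    rw [Algebra.algebraMap_eq_smul_one] at this
    exact this.symm
  refine ⟨c, fun g => ?_⟩
  calc ∑ i, f i * ρ.character (j i * g) = LinearMap.trace ℂ _ (T * ρ g) := by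
        simp [T, character, Finset.sum_mul]
    _ = c * ρ.character g := by simp [hTc, character]

end Schur

/-! ### The regular character -/

section Regular

variable (K : Type*) [Group K]

/-- The right regular representation of `K`, on the functions on `K`. -/
def rightRegular : Representation ℂ K (K → ℂ) where
  toFun g := LinearMap.funLeft ℂ ℂ (· * g)
  map_one' := by ext; simp [LinearMap.funLeft]
  map_mul' g h := by ext; simp [LinearMap.funLeft, mul_assoc]

variable [Finite K]

open Classical in
theorem character_rightRegular (g : K) :
    (rightRegular K).character g = if g = 1 then (Nat.card K : ℂ) else 0 := by
  have := Fintype.ofFinite K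
  rw [character, LinearMap.trace_eq_matrix_trace ℂ (Pi.basisFun ℂ K), Matrix.trace]
  simp only [Matrix.diag_apply, LinearMap.toMatrix_apply, Pi.basisFun_apply, Pi.basisFun_repr,
    rightRegular, MonoidHom.coe_mk, OneHom.coe_mk, LinearMap.funLeft_apply, Pi.single_apply,
    mul_eq_left]
  split_ifs <;> simp

/-- Every irreducible character `φ` occurs in the regular character, with multiplicity `φ 1`.  In
particular there are only finitely many. -/
theorem exists_regular_decomposition :
    ∃ h : (Irr K).Finite, ∀ g : K, ∑ φ ∈ h.toFinset, φ 1 * φ g =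
      (rightRegular K).character g := by
  classical
  obtain ⟨ι, _, ψ, hψ, h⟩ := exists_sum_irr (rightRegular K)
  -- The multiplicity of `φ` in the regular character is `φ 1`.
  have hmult : ∀ φ ∈ Irr K, φ 1 = (Finset.univ.filter fun i => ψ i = φ).card := by
    intro φ hφ
    have h1 : charInner (rightRegular K).character φ = φ 1 := by
      have := Fintype.ofFinite K
      rw [charInner_eq_sum]
      simp [character_rightRegular]
    rw [← h1, h, charInner_sum_left]
    simp [charInner_irr (hψ _) hφ]
  have hmem : ∀ φ ∈ Irr K, φ ∈ Finset.univ.image ψ := by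
    intro φ hφ
    have hne := irr_apply_one_ne_zero hφ
    rw [hmult φ hφ, Nat.cast_ne_zero, Finset.card_ne_zero] at hne
    obtain ⟨i, hi⟩ := hne
    exact Finset.mem_image.2 ⟨i, Finset.mem_univ _, by simpa using hi⟩
  have hfin : (Irr K).Finite := (Finset.finite_toSet _).subset hmem
  refine ⟨hfin, fun g => ?_⟩
  rw [h, Finset.sum_apply,
    ← Finset.sum_fiberwise_of_maps_to (s := Finset.univ) (t := hfin.toFinset) (g := ψ)
      (fun i _ => by simpa using hψ i)]
  refine Finset.sum_congr rfl fun φ hφ => ?_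
  rw [Finset.sum_congr rfl (g := fun _ => φ g) (fun i hi => by rw [(Finset.mem_filter.1 hi).2]),
    Finset.sum_const, nsmul_eq_mul, hmult φ (by simpa using hφ)]

theorem irr_finite : (Irr K).Finite := (exists_regular_decomposition K).1

variable {K}

open Classical in
/-- The second orthogonality relation, for the conjugacy class of `1`: the decomposition of the
regular character. -/
theorem sum_irr_apply_one_mul (g : K) :
    ∑ φ ∈ (irr_finite K).toFinset, φ 1 * φ g = if g = 1 then (Nat.card K : ℂ) else 0 := by
  rw [← character_rightRegular]
  exact (exists_regular_decomposition K).2 g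

end Regular

/-! ### Conjugate characters and Clifford's theorem -/

section Clifford

variable {G : Type*} [Group G] (N : Subgroup G) [N.Normal]

theorem conjChar_mul (g h : G) (θ : N → ℂ) :
    conjChar N h (conjChar N g θ) = conjChar N (g * h) θ := by
  ext n
  simp [conjChar]

theorem conjChar_one (θ : N → ℂ) : conjChar N 1 θ = θ := by
  ext n
  simp [conjChar]

theorem conjChar_mem_irr {θ : N → ℂ} (hθ : θ ∈ Irr N) (g : G) : conjChar N g θ ∈ Irr N :=
  comp_mem_irr hθ (MulAut.conjNormal g : N ≃* N).toMonoidHom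
    (MulAut.conjNormal g : N ≃* N).surjective

theorem conjChar_apply_one (θ : N → ℂ) (g : G) : conjChar N g θ 1 = θ 1 := by
  simp [conjChar]

variable [Finite G]

/-- The set of `G`-conjugates of a function on `N`. -/
def conjOrbit (θ : N → ℂ) : Finset (N → ℂ) :=
  (Set.finite_range fun g : G => conjChar N g θ).toFinset

variable {N}

theorem mem_conjOrbit {θ φ : N → ℂ} : φ ∈ conjOrbit N θ ↔ ∃ g, conjChar N g θ = φ := by
  simp [conjOrbit]

theorem self_mem_conjOrbit (θ : N → ℂ) : θ ∈ conjOrbit N θ :=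
  mem_conjOrbit.2 ⟨1, conjChar_one N θ⟩

theorem conjChar_hat (θ : N → ℂ) (g : G) : conjChar N g (hat N θ) = hat N θ := by
  have hsum : conjChar N g (hat N θ) = ∑ φ ∈ conjOrbit N θ, conjChar N g φ := by
    ext n
    simp [conjChar, hat, conjOrbit]
  rw [hsum]
  refine Finset.sum_bij (fun φ _ => conjChar N g φ) ?_ ?_ ?_ (fun _ _ => rfl)
  · intro φ hφ
    obtain ⟨h, rfl⟩ := mem_conjOrbit.1 hφ
    exact mem_conjOrbit.2 ⟨_, (conjChar_mul N h g θ).symm⟩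
  · intro φ _ ψ _ h
    have := congrArg (conjChar N g⁻¹) h
    simpa only [conjChar_mul, mul_inv_cancel, conjChar_one] using this
  · intro ψ hψ
    obtain ⟨h, rfl⟩ := mem_conjOrbit.1 hψ
    exact ⟨conjChar N (h * g⁻¹) θ, mem_conjOrbit.2 ⟨_, rfl⟩, by simp [conjChar_mul]⟩

theorem charInner_hat {θ φ : N → ℂ} (hθ : θ ∈ Irr N) (hφ : φ ∈ Irr N) :
    charInner φ (hat N θ) ≠ 0 ↔ φ ∈ conjOrbit N θ := by
  classical
  have h : charInner φ (hat N θ) = ∑ ψ ∈ conjOrbit N θ, if φ = ψ then 1 else 0 := by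
    rw [hat, charInner_sum_right]
    refine Finset.sum_congr rfl fun ψ hψ => ?_
    obtain ⟨g, rfl⟩ := mem_conjOrbit.1 hψ
    exact charInner_irr hφ (conjChar_mem_irr N hθ g)
  rw [h]
  simp

/-- Clifford's theorem: the irreducible constituents of the restriction to `N` of an irreducible
character of `G` are conjugate.  The class sum weighted by `θ̂` acts as a scalar on the whole
representation of `G`, hence by the same scalar on each constituent, and this scalar detects
membership in the orbit of `θ`. -/
theorem mem_conjOrbit_of_restrict {χ : G → ℂ} (hχ : χ ∈ Irr G) {θ φ : N → ℂ} (hθ : θ ∈ Irr N)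
    (hφ : φ ∈ Irr N) (h1 : charInner (fun n : N => χ n) θ ≠ 0)
    (h2 : charInner (fun n : N => χ n) φ ≠ 0) : φ ∈ conjOrbit N θ := by
  classical
  have := Fintype.ofFinite N
  let F : N → ℂ := fun n => hat N θ n⁻¹
  have hF : ∀ (g : G) (n : N), F (MulAut.conjNormal g n) = F n := fun g n => by
    have := congrFun (conjChar_hat θ g) n⁻¹
    simpa [conjChar, F] using this
  obtain ⟨c, hc⟩ := exists_convolution_eq hχ (fun n : N => (n : G)) F fun g =>
    ⟨(MulAut.conjNormal g : N ≃* N).toEquiv, fun n => ⟨by simp, hF g n⟩⟩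
  have hN : ∀ ψ ∈ Irr N, ∃ d : ℂ, ∀ m, ∑ n, F n * ψ (n * m) = d * ψ m := fun ψ hψ =>
    exists_convolution_eq hψ id F fun k =>
      ⟨(MulAut.conj k).toEquiv, fun n => ⟨by simp, by
        have := hF k n
        rwa [show MulAut.conjNormal (k : G) n = MulAut.conj k n from Subtype.ext (by simp)] at this⟩⟩
  choose! d hd using hN
  obtain ⟨ι, _, ψ, hψ, hsum⟩ := exists_sum_irr_of_comp hχ N.subtype
  have hres : (fun n : N => χ n) = ∑ i, ψ i := hsum
  have hres' : ∀ n : N, χ n = ∑ i, ψ i n := fun n => by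
    simpa using congrFun hres n
  have hlin : ∑ i, d (ψ i) • ψ i = ∑ i, c • ψ i := by
    ext m
    have h := hc m
    simp only [← Subgroup.coe_mul, hres', Finset.mul_sum] at h
    rw [Finset.sum_comm] at h
    simp only [hd _ (hψ _)] at h
    simpa using h
  have key : ∀ η ∈ Irr N, charInner (fun n : N => χ n) η ≠ 0 → d η = c := by
    intro η hη hne
    have h := congrArg (charInner · η) hlin
    simp only [charInner_sum_left, charInner_smul_left] at h
    have h' : ∑ i, d (ψ i) * charInner (ψ i) η = d η * ∑ i, charInner (ψ i) η := by
      rw [Finset.mul_sum]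
      refine Finset.sum_congr rfl fun i _ => ?_
      rw [charInner_irr (hψ i) hη]
      split_ifs with hi <;> simp [hi]
    rw [h', ← Finset.mul_sum, ← charInner_sum_left, ← hres] at h
    exact mul_right_cancel₀ hne h
  have hval : ∀ η ∈ Irr N, d η * η 1 = Nat.card N * charInner η (hat N θ) := by
    intro η hη
    rw [← hd η hη 1, card_mul_charInner]
    exact Finset.sum_congr rfl fun n _ => by simp [F, mul_comm]
  have hcard : (Nat.card N : ℂ) ≠ 0 := by exact_mod_cast Nat.card_pos.ne'
  rw [← charInner_hat hθ hφ]
  intro h0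
  have hdφ : d φ = 0 := by
    have := hval φ hφ
    rw [h0, mul_zero] at this
    exact (mul_eq_zero.1 this).resolve_right (irr_apply_one_ne_zero hφ)
  have hdθ := hval θ hθ
  rw [key θ hθ h1, ← key φ hφ h2, hdφ, zero_mul] at hdθ
  exact mul_ne_zero hcard ((charInner_hat hθ hθ).2 (self_mem_conjOrbit θ)) hdθ.symm

omit [N.Normal] in
/-- Every irreducible character of a subgroup lies under one of the whole group. -/
theorem exists_mem_irrOver {φ : N → ℂ} (hφ : φ ∈ Irr N) : ∃ χ, χ ∈ IrrOver N φ := by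
  classical
  have := Fintype.ofFinite N
  by_contra! h
  have h0 : ∀ χ ∈ Irr G, charInner (fun n : N => χ n) φ = 0 := fun χ hχ => by
    by_contra hne
    exact h χ ⟨hχ, hne⟩
  have hreg : charInner (∑ χ ∈ (irr_finite G).toFinset, χ 1 • fun n : N => χ n) φ = 0 := by
    rw [charInner_sum_left]
    refine Finset.sum_eq_zero fun χ hχ => ?_
    rw [charInner_smul_left, h0 χ (by simpa using hχ), mul_zero]
  have hsum : (∑ χ ∈ (irr_finite G).toFinset, χ 1 • fun n : N => χ n) =
      fun n : N => if n = 1 then (Nat.card G : ℂ) else 0 := by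
    ext n
    simpa using sum_irr_apply_one_mul (n : G)
  rw [hsum, charInner_eq_sum] at hreg
  simp [irr_apply_one_ne_zero hφ, Nat.card_pos.ne'] at hreg

end Clifford

/-! ### Characters over an invariant linear character -/

section LinearPairs

variable {G : Type*} [Group G] {N H : Subgroup G}

/-- The character `φ` of `N` lies over the character `l` of the subgroup `H ≤ N`: the restriction
of `φ` to `H` has `l` as a constituent. -/
def LiesOver (hHN : H ≤ N) (l : H → ℂ) (φ : N → ℂ) : Prop :=
  charInner (φ ∘ Subgroup.inclusion hHN) l ≠ 0

theorem one_mem_linG [H.Normal] : (1 : H → ℂ) ∈ LinG H :=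
  ⟨one_mem_irr, rfl, fun _ => rfl⟩

theorem linG_conj [H.Normal] {l : H → ℂ} (hl : l ∈ LinG H) (g : G) (h : H) :
    l (MulAut.conjNormal g h) = l h :=
  congrFun (hl.2.2 g) h

theorem linG_mul_inv [H.Normal] {l : H → ℂ} (hl : l ∈ LinG H) (h : H) : l h * l h⁻¹ = 1 := by
  rw [← linear_map_mul hl.1 hl.2.1, mul_inv_cancel, hl.2.1]

/-- A `G`-invariant linear character of `H` is trivial on `[H, G]`. -/
theorem linG_eq_one_of_mem_commutator [H.Normal] {l : H → ℂ} (hl : l ∈ LinG H) {x : G}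
    (hx : x ∈ ⁅H, (⊤ : Subgroup G)⁆) : ∃ hxH : x ∈ H, l ⟨x, hxH⟩ = 1 := by
  let K : Subgroup G :=
    { carrier := {x | ∃ hxH : x ∈ H, l ⟨x, hxH⟩ = 1}
      one_mem' := ⟨H.one_mem, hl.2.1⟩
      mul_mem' := by
        rintro a b ⟨ha, ha1⟩ ⟨hb, hb1⟩
        refine ⟨H.mul_mem ha hb, ?_⟩
        have := linear_map_mul hl.1 hl.2.1 ⟨a, ha⟩ ⟨b, hb⟩
        rwa [ha1, hb1, mul_one] at this
      inv_mem' := by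
        rintro a ⟨ha, ha1⟩
        refine ⟨H.inv_mem ha, ?_⟩
        have := linG_mul_inv hl ⟨a, ha⟩
        rwa [ha1, one_mul] at this }
  suffices ⁅H, (⊤ : Subgroup G)⁆ ≤ K from this hx
  rw [Subgroup.commutator_le]
  intro h hh g _
  have hconj : g * h⁻¹ * g⁻¹ ∈ H := ‹H.Normal›.conj_mem _ (H.inv_mem hh) g
  rw [commutatorElement_def, show h * g * h⁻¹ * g⁻¹ = h * (g * h⁻¹ * g⁻¹) by group]
  refine ⟨H.mul_mem hh hconj, ?_⟩
  calc l ⟨h * (g * h⁻¹ * g⁻¹), _⟩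
      = l ⟨h, hh⟩ * l (MulAut.conjNormal g (⟨h, hh⟩⁻¹ : H)) := by
        rw [← linear_map_mul hl.1 hl.2.1]
        congr 1
    _ = 1 := by rw [linG_conj hl, linG_mul_inv hl]

variable [Finite G]

theorem LiesOver.conjChar [N.Normal] [H.Normal] {hHN : H ≤ N} {l : H → ℂ} (hl : l ∈ LinG H)
    {φ : N → ℂ} (hφ : LiesOver hHN l φ) (g : G) : LiesOver hHN l (conjChar N g φ) := by
  have := Fintype.ofFinite H
  unfold LiesOver at hφ ⊢
  convert hφ using 1
  rw [charInner_eq_sum, charInner_eq_sum]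
  congr 1
  refine Fintype.sum_equiv (MulAut.conjNormal g : H ≃* H).toEquiv _ _ fun h => ?_
  have h1 : l ((MulAut.conjNormal g) h)⁻¹ = l h⁻¹ := by
    rw [← map_inv, linG_conj hl]
  have h2 : (MulAut.conjNormal g) (Subgroup.inclusion hHN h) =
      Subgroup.inclusion hHN (MulAut.conjNormal g h) := Subtype.ext (by simp)
  simp [GChar.conjChar, h1, h2]

theorem LiesOver.of_mem_conjOrbit [N.Normal] [H.Normal] {hHN : H ≤ N} {l : H → ℂ}
    (hl : l ∈ LinG H) {θ φ : N → ℂ} (hθ : LiesOver hHN l θ) (hφ : φ ∈ conjOrbit N θ) :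
    LiesOver hHN l φ := by
  obtain ⟨g, rfl⟩ := mem_conjOrbit.1 hφ
  exact hθ.conjChar hl g

omit [Finite G] in
/-- Averaging an irreducible character of `N` over `H` against `l` multiplies it by a scalar. -/
theorem exists_sum_linG_mul_eq [H.Normal] (hHN : H ≤ N) [Fintype H] {l : H → ℂ} (hl : l ∈ LinG H)
    {φ : N → ℂ} (hφ : φ ∈ Irr N) :
    ∃ c : ℂ, c * φ 1 = Nat.card H * charInner (φ ∘ Subgroup.inclusion hHN) l ∧
      ∀ n, ∑ h : H, l h⁻¹ * φ (Subgroup.inclusion hHN h * n) = c * φ n := by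
  obtain ⟨c, hc⟩ := exists_convolution_eq hφ (Subgroup.inclusion hHN) (fun h => l h⁻¹) fun k =>
    ⟨(MulAut.conjNormal (k : G) : H ≃* H).toEquiv, fun h => ⟨Subtype.ext (by simp), by
      change l (MulAut.conjNormal (k : G) h)⁻¹ = _
      rw [← map_inv, linG_conj hl]⟩⟩
  refine ⟨c, ?_, hc⟩
  rw [← hc 1, card_mul_charInner]
  simp [mul_comm]

/-- A character lying over a `G`-invariant linear character restricts to a multiple of it. -/
theorem LiesOver.apply_eq [H.Normal] {hHN : H ≤ N} {l : H → ℂ} (hl : l ∈ LinG H)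
    {φ : N → ℂ} (hφ : φ ∈ Irr N) (hover : LiesOver hHN l φ) (h : H) :
    φ (Subgroup.inclusion hHN h) = φ 1 * l h := by
  have := Fintype.ofFinite H
  obtain ⟨c, hc1, hc⟩ := exists_sum_linG_mul_eq hHN hl hφ
  have hc0 : c ≠ 0 := by
    rintro rfl
    rw [zero_mul] at hc1
    exact mul_ne_zero (by exact_mod_cast Nat.card_pos.ne') hover hc1.symm
  apply mul_left_cancel₀ hc0
  calc c * φ (Subgroup.inclusion hHN h)
      = ∑ k : H, l k⁻¹ * φ (Subgroup.inclusion hHN k * Subgroup.inclusion hHN h) := (hc _).symm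
    _ = ∑ k : H, l h * (l k⁻¹ * φ (Subgroup.inclusion hHN k * 1)) := by
        refine Fintype.sum_equiv (Equiv.mulRight h) _ _ fun k => ?_
        have : l k⁻¹ = l h * l (k * h)⁻¹ := by
          rw [← linear_map_mul hl.1 hl.2.1]; simp
        simp [this, mul_assoc]
    _ = c * (φ 1 * l h) := by rw [← Finset.mul_sum, hc]; ring

open Classical in
/-- The scalar of `exists_sum_linG_mul_eq` is `|H|` or `0`, according to whether `φ` lies over
`l`. -/
theorem sum_linG_mul_eq [H.Normal] (hHN : H ≤ N) [Fintype H] {l : H → ℂ} (hl : l ∈ LinG H)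
    {φ : N → ℂ} (hφ : φ ∈ Irr N) (n : N) :
    ∑ h : H, l h⁻¹ * φ (Subgroup.inclusion hHN h * n) =
      if LiesOver hHN l φ then (Nat.card H : ℂ) * φ n else 0 := by
  obtain ⟨c, hc1, hc⟩ := exists_sum_linG_mul_eq hHN hl hφ
  have h1 := irr_apply_one_ne_zero hφ
  rw [hc]
  split_ifs with hover
  · have : charInner (φ ∘ Subgroup.inclusion hHN) l = φ 1 := by
      rw [charInner_eq_sum]
      simp only [Function.comp_apply, hover.apply_eq hl hφ, mul_assoc, linG_mul_inv hl]
      simp [mul_comm]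
    rw [this] at hc1
    rw [mul_right_cancel₀ h1 hc1]
  · rw [not_not.1 hover, mul_zero] at hc1
    rw [(mul_eq_zero.1 hc1).resolve_right h1, zero_mul]

open Classical in
/-- The irreducible characters of `N` lying over `l`. -/
def irrLiesOver (hHN : H ≤ N) (l : H → ℂ) : Finset (N → ℂ) :=
  (irr_finite N).toFinset.filter (LiesOver hHN l)

theorem mem_irrLiesOver {hHN : H ≤ N} {l : H → ℂ} {φ : N → ℂ} :
    φ ∈ irrLiesOver hHN l ↔ φ ∈ Irr N ∧ LiesOver hHN l φ := by
  simp [irrLiesOver]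

open Classical in
/-- The decomposition of the character of `N` induced from `l`, obtained by averaging that of the
regular character of `N` against `l`. -/
theorem card_mul_sum_irrLiesOver [H.Normal] (hHN : H ≤ N) {l : H → ℂ} (hl : l ∈ LinG H) (n : N) :
    (Nat.card H : ℂ) * ∑ φ ∈ irrLiesOver hHN l, φ 1 * φ n =
      if h : (n : G) ∈ H then Nat.card N * l ⟨n, h⟩ else 0 := by
  have := Fintype.ofFinite H
  calc (Nat.card H : ℂ) * ∑ φ ∈ irrLiesOver hHN l, φ 1 * φ n
      = ∑ φ ∈ (irr_finite N).toFinset,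
          φ 1 * ∑ h : H, l h⁻¹ * φ (Subgroup.inclusion hHN h * n) := by
        rw [irrLiesOver, Finset.sum_filter, Finset.mul_sum]
        refine Finset.sum_congr rfl fun φ hφ => ?_
        rw [sum_linG_mul_eq hHN hl (by simpa using hφ)]
        split_ifs <;> ring
    _ = ∑ h : H, l h⁻¹ * ∑ φ ∈ (irr_finite N).toFinset,
          φ 1 * φ (Subgroup.inclusion hHN h * n) := by
        simp only [Finset.mul_sum]
        rw [Finset.sum_comm]
        exact Finset.sum_congr rfl fun _ _ => Finset.sum_congr rfl fun _ _ => by ring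
    _ = ∑ h : H, l h⁻¹ * if Subgroup.inclusion hHN h * n = 1 then (Nat.card N : ℂ) else 0 := by
        refine Finset.sum_congr rfl fun h _ => ?_
        rw [sum_irr_apply_one_mul]
        congr
    _ = _ := by
        split_ifs with hn
        · rw [Finset.sum_eq_single (⟨n, hn⟩⁻¹ : H)]
          · rw [if_pos (Subtype.ext (by simp)), inv_inv, mul_comm]
          · intro h _ hne
            rw [if_neg, mul_zero]
            intro h1
            refine hne (eq_inv_of_mul_eq_one_left (Subtype.ext ?_))
            simpa using congrArg Subtype.val h1
          · simp
        · refine Finset.sum_eq_zero fun h _ => ?_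
          rw [if_neg, mul_zero]
          intro h1
          apply hn
          have : (h : G) * n = 1 := by simpa using congrArg Subtype.val h1
          rw [← inv_eq_of_mul_eq_one_right this]
          exact H.inv_mem h.2

theorem card_mul_sum_irrLiesOver_one [H.Normal] (hHN : H ≤ N) {l : H → ℂ} (hl : l ∈ LinG H) :
    (Nat.card H : ℂ) * ∑ φ ∈ irrLiesOver hHN l, φ 1 * φ 1 = Nat.card N := by
  rw [card_mul_sum_irrLiesOver hHN hl, dif_pos (show ((1 : N) : G) ∈ H from H.one_mem)]
  rw [show (⟨((1 : N) : G), H.one_mem⟩ : H) = 1 from rfl, hl.2.1, mul_one]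

/-- `H` is the intersection of the kernels of the irreducible characters of `N` lying over the
trivial character of `H`. -/
theorem mem_of_forall_apply_eq [H.Normal] (hHN : H ≤ N) {n : N}
    (hn : ∀ φ ∈ Irr N, LiesOver hHN 1 φ → φ n = φ 1) : (n : G) ∈ H := by
  by_contra h
  have h1 := card_mul_sum_irrLiesOver hHN one_mem_linG n
  rw [dif_neg h, Finset.sum_congr rfl fun φ hφ => by
    rw [hn φ (mem_irrLiesOver.1 hφ).1 (mem_irrLiesOver.1 hφ).2],
    card_mul_sum_irrLiesOver_one hHN one_mem_linG] at h1
  exact Nat.card_pos.ne' (by exact_mod_cast h1)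

/-- The irreducible characters of `N` have trivial common kernel. -/
theorem eq_one_of_forall_apply_eq {n : N} (hn : ∀ φ ∈ Irr N, φ n = φ 1) : n = 1 := by
  have := mem_of_forall_apply_eq (bot_le : ⊥ ≤ N) fun φ hφ _ => hn φ hφ
  exact Subtype.ext (by simpa using this)

/-- If `(H, l)` is a linear `G`-character pair for `θ`, the characters of `N` lying over `l` are
the conjugates of `θ`. -/
theorem IsLinearGPair.irrLiesOver_eq [N.Normal] [H.Normal] {θ : N → ℂ} {l : H → ℂ}
    (hp : IsLinearGPair N θ H l) (hθ : θ ∈ Irr N) : irrLiesOver hp.1 l = conjOrbit N θ := by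
  obtain ⟨hHN, hl, hirr⟩ := hp
  have restrict : ∀ {χ : G → ℂ}, χ ∈ Irr G → ∃ (ι : Type) (_ : Fintype ι) (ψ : ι → N → ℂ),
      (∀ i, ψ i ∈ Irr N) ∧ (fun n : N => χ n) = ∑ i, ψ i ∧ (fun h : H => χ h) =
        ∑ i, ψ i ∘ Subgroup.inclusion hHN := by
    intro χ hχ
    obtain ⟨ι, _, ψ, hψ, hsum⟩ := exists_sum_irr_of_comp hχ N.subtype
    refine ⟨ι, inferInstance, ψ, hψ, hsum, ?_⟩
    ext h
    simpa using congrFun hsum (Subgroup.inclusion hHN h)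
  -- A character of `G` over `φ` is over `l`, hence over `θ`, and Clifford's theorem applies.
  have h1 : ∀ φ ∈ Irr N, LiesOver hHN l φ → φ ∈ conjOrbit N θ := by
    intro φ hφ hover
    obtain ⟨χ, hχ, hχφ⟩ := exists_mem_irrOver hφ
    have hχl : χ ∈ IrrOver H l := by
      refine ⟨hχ, ?_⟩
      obtain ⟨ι, _, ψ, hψ, hsN, hsH⟩ := restrict hχ
      rw [hsN, charInner_sum_left] at hχφ
      obtain ⟨i, -, hi⟩ := Finset.exists_ne_zero_of_sum_ne_zero hχφ
      rw [charInner_irr (hψ i) hφ] at hi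
      obtain rfl : ψ i = φ := by by_contra hne; simp [hne] at hi
      choose m hm using fun i => charInner_comp_irr_nat (hψ i) (Subgroup.inclusion hHN) hl.1
      rw [hsH, charInner_sum_left, Finset.sum_congr rfl fun i _ => hm i]
      have hi0 : m i ≠ 0 := by
        have := hover
        rw [LiesOver, hm i] at this
        exact_mod_cast this
      rw [← Nat.cast_sum, Nat.cast_ne_zero]
      exact fun h0 => hi0 (Finset.sum_eq_zero_iff.1 h0 i (Finset.mem_univ i))
    rw [← hirr] at hχl
    exact mem_conjOrbit_of_restrict hχ hθ hφ hχl.2 hχφ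
  have h2 : LiesOver hHN l θ := by
    obtain ⟨χ, hχθ⟩ := exists_mem_irrOver hθ
    have hχl := hχθ
    rw [hirr] at hχl
    obtain ⟨ι, _, ψ, hψ, hsN, hsH⟩ := restrict hχθ.1
    have hχl2 := hχl.2
    rw [hsH, charInner_sum_left] at hχl2
    obtain ⟨i, -, hi⟩ := Finset.exists_ne_zero_of_sum_ne_zero hχl2
    have hmem := h1 (ψ i) (hψ i) hi
    obtain ⟨g, hg⟩ := mem_conjOrbit.1 hmem
    have : conjChar N g⁻¹ (ψ i) = θ := by
      rw [← hg, conjChar_mul, mul_inv_cancel, conjChar_one]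
    exact LiesOver.of_mem_conjOrbit hl hi (mem_conjOrbit.2 ⟨_, this⟩)
  ext φ
  rw [mem_irrLiesOver]
  refine ⟨fun h => h1 φ h.1 h.2, fun h => ⟨?_, h2.of_mem_conjOrbit hl h⟩⟩
  obtain ⟨g, rfl⟩ := mem_conjOrbit.1 h
  exact conjChar_mem_irr N hθ g

end LinearPairs

/-! ### The lower central `G`-series -/

section LowerSeries

variable {G : Type*} [Group G] (N : Subgroup G) [N.Normal]

theorem lowerGSeries_normal : ∀ r, (lowerGSeries N r).Normal
  | 0 => ‹N.Normal›
  | 1 => ‹N.Normal›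
  | r + 2 => by
    have := lowerGSeries_normal (r + 1)
    exact Subgroup.commutator_normal _ _

theorem lowerGSeries_antitone : Antitone (lowerGSeries N) := by
  refine antitone_nat_of_succ_le fun r => ?_
  cases r with
  | zero => exact le_rfl
  | succ r =>
    have := lowerGSeries_normal N (r + 1)
    exact Subgroup.commutator_le_left _ _

theorem lowerGSeries_le (r : ℕ) : lowerGSeries N r ≤ N :=
  lowerGSeries_antitone N (Nat.zero_le r)

end LowerSeries

/-! ### Degrees of leader characters -/

section Degrees

variable {G : Type*} [Group G] [Finite G] {N : Subgroup G} [N.Normal]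

theorem mul_hat_apply_one (θ : N → ℂ) :
    θ 1 * hat N θ 1 = ∑ φ ∈ conjOrbit N θ, φ 1 * φ 1 := by
  rw [hat, Finset.sum_apply, Finset.mul_sum]
  refine Finset.sum_congr rfl fun φ hφ => ?_
  obtain ⟨g, rfl⟩ := mem_conjOrbit.1 hφ
  rw [conjChar_apply_one]

theorem exists_nat_mul_hat_apply_one {θ : N → ℂ} (hθ : θ ∈ Irr N) :
    ∃ d : ℕ, 0 < d ∧ θ 1 * hat N θ 1 = d := by
  obtain ⟨n, hn, h⟩ := irr_apply_one hθ
  refine ⟨(conjOrbit N θ).card * (n * n),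
    Nat.mul_pos (Finset.card_pos.2 ⟨θ, self_mem_conjOrbit θ⟩) (Nat.mul_pos hn hn), ?_⟩
  rw [mul_hat_apply_one, Finset.sum_congr rfl (g := fun _ => (n * n : ℂ))]
  · simp
  · intro φ hφ
    obtain ⟨g, rfl⟩ := mem_conjOrbit.1 hφ
    rw [conjChar_apply_one, h]

theorem lcd_finite : (Lcd N).Finite := by
  refine ((irr_finite N).image fun θ => θ 1 * hat N θ 1).subset ?_
  rintro d ⟨θ, hθ, rfl⟩
  exact ⟨θ, hθ, rfl⟩

theorem one_mem_lcd : (1 : ℂ) ∈ Lcd N := by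
  refine ⟨1, one_mem_irr, ?_⟩
  have : conjOrbit N (1 : N → ℂ) = {1} := by
    ext φ
    simp only [mem_conjOrbit, Finset.mem_singleton]
    exact ⟨fun ⟨_, h⟩ => h.symm, fun h => ⟨1, h.symm⟩⟩
  rw [mul_hat_apply_one, this]
  simp

open scoped ComplexOrder in
/-- Relative to a pair `(H, l)` for `θ`, every non-trivial irreducible character of `N / H` has a
leader character of degree smaller than that of `θ`: the characters over `l` and those over the
trivial character of `H` both have squared degrees adding up to `|N : H|`, and the orbit of a
non-trivial character misses the trivial one. -/
theorem IsLinearGPair.mul_hat_apply_one_lt {H : Subgroup G} [H.Normal] {θ φ : N → ℂ} {l : H → ℂ}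
    (hp : IsLinearGPair N θ H l) (hθ : θ ∈ Irr N) (hφ : φ ∈ Irr N) (hover : LiesOver hp.1 1 φ)
    (hne : φ ≠ 1) : φ 1 * hat N φ 1 < θ 1 * hat N θ 1 := by
  have hH : (Nat.card H : ℂ) ≠ 0 := by exact_mod_cast Nat.card_pos.ne'
  have heq : ∑ ψ ∈ irrLiesOver hp.1 (1 : H → ℂ), ψ 1 * ψ 1 = θ 1 * hat N θ 1 := by
    rw [mul_hat_apply_one, ← hp.irrLiesOver_eq hθ]
    apply mul_left_cancel₀ hH
    rw [card_mul_sum_irrLiesOver_one hp.1 one_mem_linG, card_mul_sum_irrLiesOver_one hp.1 hp.2.1]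
  rw [← heq, mul_hat_apply_one]
  refine Finset.sum_lt_sum_of_subset (i := 1) ?_ ?_ ?_ ?_ ?_
  · intro ψ hψ
    rw [mem_irrLiesOver]
    refine ⟨?_, hover.of_mem_conjOrbit one_mem_linG hψ⟩
    obtain ⟨g, rfl⟩ := mem_conjOrbit.1 hψ
    exact conjChar_mem_irr N hφ g
  · refine mem_irrLiesOver.2 ⟨one_mem_irr, ?_⟩
    have : charInner (1 : H → ℂ) 1 ≠ 0 := by simp [charInner_irr one_mem_irr one_mem_irr]
    exact this
  · intro h1
    obtain ⟨g, hg⟩ := mem_conjOrbit.1 h1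
    apply hne
    rw [← conjChar_one N φ, ← mul_inv_cancel g, ← conjChar_mul, hg]
    rfl
  · simp
  · intro ψ hψ _
    obtain ⟨n, -, hn⟩ := irr_apply_one (mem_irrLiesOver.1 hψ).1
    rw [hn]
    positivity

open scoped ComplexOrder in
/-- The inductive step.  Let `(H, l)` be a pair for `θ`.  The smaller leader degrees force
`Γ^{r+1} ≤ H`, so `Γ^{r+2} ≤ [H, G]`, on which `l` is trivial, and the conjugates of `θ` restrict to
multiples of `l`.  That is: if `Γ^{r+1}` lies in the kernels of all irreducible characters of `N` whose
leader character has degree smaller than that of `θ`, then `Γ^{r+2}` lies in the kernel of every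
conjugate of `θ`. -/
theorem apply_eq_of_mem_lowerGSeries (hN : IsNMISubgroup N) {θ : N → ℂ} (hθ : θ ∈ Irr N) (r : ℕ)
    {d : ℕ} (hd : θ 1 * hat N θ 1 = d)
    (ih : ∀ φ ∈ Irr N, ∀ e : ℕ, φ 1 * hat N φ 1 = e → e < d →
      ∀ x : N, (x : G) ∈ lowerGSeries N (r + 1) → φ x = φ 1)
    {φ : N → ℂ} (hφ : φ ∈ conjOrbit N θ) {x : N} (hx : (x : G) ∈ lowerGSeries N (r + 2)) :
    φ x = φ 1 := by
  obtain ⟨H, hH, l, hp⟩ := hN θ hθ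
  have hle : lowerGSeries N (r + 1) ≤ H := by
    intro y hy
    refine mem_of_forall_apply_eq hp.1 (n := ⟨y, lowerGSeries_le N _ hy⟩) fun ψ hψ hover => ?_
    by_cases hne : ψ = 1
    · rw [hne]; rfl
    obtain ⟨e, -, he⟩ := exists_nat_mul_hat_apply_one hψ
    refine ih ψ hψ e he ?_ _ hy
    have := hp.mul_hat_apply_one_lt hθ hψ hover hne
    rw [he, hd] at this
    exact_mod_cast this
  obtain ⟨hxH, hlx⟩ := linG_eq_one_of_mem_commutator hp.2.1
    (Subgroup.commutator_mono hle le_rfl hx)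
  rw [← hp.irrLiesOver_eq hθ, mem_irrLiesOver] at hφ
  have := hφ.2.apply_eq hp.2.1 hφ.1 ⟨x, hxH⟩
  rwa [hlx, mul_one] at this

variable (N) in
/-- The leader degrees are finitely many natural numbers, so they can be listed in increasing
order. -/
theorem exists_enumeratesLcd : ∃ (s : ℕ) (f : ℕ → ℕ), EnumeratesLcd N s f := by
  have hnat : ∀ d ∈ Lcd N, ∃ n : ℕ, (n : ℂ) = d := by
    rintro d ⟨θ, hθ, rfl⟩
    obtain ⟨n, -, h⟩ := exists_nat_mul_hat_apply_one hθ
    exact ⟨n, h.symm⟩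
  let S : Set ℕ := (fun n : ℕ => (n : ℂ)) ⁻¹' Lcd N
  have hS : S.Finite := lcd_finite.preimage Nat.cast_injective.injOn
  have hSim : (fun n : ℕ => (n : ℂ)) '' S = Lcd N := Set.image_preimage_eq_of_subset hnat
  let e := hS.toFinset.orderIsoOfFin rfl
  refine ⟨hS.toFinset.card,
    fun i => if h : i - 1 < hS.toFinset.card then e ⟨i - 1, h⟩ else 0, ?_, ?_⟩
  · intro i hi j hj hij
    simp only [Set.mem_Icc] at hi hj
    have hi' : i - 1 < hS.toFinset.card := by omega
    have hj' : j - 1 < hS.toFinset.card := by omega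
    simp only [hi', hj', dif_pos]
    exact e.strictMono (show (⟨i - 1, hi'⟩ : Fin _) < ⟨j - 1, hj'⟩ from Fin.mk_lt_mk.2 (by omega))
  · rw [← hSim]
    ext d
    constructor
    · rintro ⟨i, hi, rfl⟩
      simp only [Set.mem_Icc] at hi
      have hi' : i - 1 < hS.toFinset.card := by omega
      refine ⟨e ⟨i - 1, hi'⟩, hS.mem_toFinset.1 (e ⟨i - 1, hi'⟩).2, ?_⟩
      simp [hi']
    · rintro ⟨n, hn, rfl⟩
      obtain ⟨k, hk⟩ := e.surjective ⟨n, by simpa using hn⟩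
      refine ⟨k + 1, ⟨by omega, by have := k.2; omega⟩, ?_⟩
      have : ((k : ℕ) + 1 - 1) < hS.toFinset.card := by have := k.2; omega
      simp [hk]

theorem EnumeratesLcd.eq_ncard {s : ℕ} {f : ℕ → ℕ} (hf : EnumeratesLcd N s f) :
    s = (Lcd N).ncard := by
  have hinj : Set.InjOn (fun i => (f i : ℂ)) (Set.Icc 1 s) := fun i hi j hj h =>
    hf.1.injOn hi hj (Nat.cast_injective h)
  rw [← hf.2, hinj.ncard_image, ← Finset.coe_Icc, Set.ncard_coe_finset, Nat.card_Icc,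
    Nat.add_sub_cancel]

theorem EnumeratesLcd.exists_index {s : ℕ} {f : ℕ → ℕ} (hf : EnumeratesLcd N s f) {d : ℕ}
    (hd : (d : ℂ) ∈ Lcd N) : ∃ i ∈ Set.Icc 1 s, f i = d := by
  rw [← hf.2] at hd
  obtain ⟨i, hi, h⟩ := hd
  exact ⟨i, hi, Nat.cast_injective h⟩

theorem EnumeratesLcd.apply_one {s : ℕ} {f : ℕ → ℕ} (hf : EnumeratesLcd N s f) :
    1 ≤ s ∧ f 1 = 1 := by
  obtain ⟨j, hj, hj1⟩ := hf.exists_index (d := 1) (by simpa using one_mem_lcd)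
  have hs : 1 ≤ s := hj.1.trans hj.2
  refine ⟨hs, le_antisymm ((hf.1.monotoneOn ⟨le_rfl, hs⟩ hj hj.1).trans_eq hj1) ?_⟩
  have h1 : (f 1 : ℂ) ∈ Lcd N := by
    rw [← hf.2]
    exact ⟨1, ⟨le_rfl, hs⟩, rfl⟩
  obtain ⟨θ, hθ, h⟩ := h1
  obtain ⟨n, hn, h'⟩ := exists_nat_mul_hat_apply_one hθ
  rw [h, Nat.cast_inj] at h'
  omega

/-- The kernel statement is proved for each conjugate of `θ` separately, which is the form that the
induction on the index of the degree needs. -/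
theorem EnumeratesLcd.apply_eq_of_mem_lowerGSeries (hN : IsNMISubgroup N) {s : ℕ} {f : ℕ → ℕ}
    (hf : EnumeratesLcd N s f) {i : ℕ} (hi : i ∈ Set.Icc 1 s) {θ : N → ℂ} (hθ : θ ∈ Irr N)
    (hd : θ 1 * hat N θ 1 = f i) {φ : N → ℂ} (hφ : φ ∈ conjOrbit N θ) {x : N}
    (hx : (x : G) ∈ lowerGSeries N (i + 1)) : φ x = φ 1 := by
  induction i using Nat.strong_induction_on generalizing θ φ x with
  | _ i ih =>
  obtain ⟨r, rfl⟩ : ∃ r, i = r + 1 := ⟨i - 1, by have := hi.1; omega⟩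
  refine GChar.apply_eq_of_mem_lowerGSeries hN hθ r hd (fun ψ hψ e he hlt y hy => ?_) hφ hx
  obtain ⟨j, hj, rfl⟩ := hf.exists_index (d := e) ⟨ψ, hψ, he⟩
  have hji : j < r + 1 := (hf.1.lt_iff_lt hj hi).1 hlt
  exact ih j hji hj hψ he (self_mem_conjOrbit ψ) (lowerGSeries_antitone N hji hy)

end Degrees

end GChar

end

theorem theorem3p20 {G : Type*} [Group G] [Finite G] (N : Subgroup G) [N.Normal]
    (hN : GChar.IsNMISubgroup N) :
    (∃ (s : ℕ) (f : ℕ → ℕ), GChar.EnumeratesLcd N s f) ∧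
    (∀ (s : ℕ) (f : ℕ → ℕ), GChar.EnumeratesLcd N s f →
      s = (GChar.Lcd N).ncard ∧ 1 ≤ s ∧ f 1 = 1 ∧
      ∀ i ∈ Set.Icc 1 s, ∀ θ ∈ GChar.Irr N, θ 1 * GChar.hat N θ 1 = (f i : ℂ) →
        (GChar.lowerGSeries N (i + 1) : Set G) ⊆
          Subtype.val '' GChar.charKer (GChar.hat N θ)) ∧
    GChar.IsHypercentral N ∧
    GChar.hypercentralLength N ≤ (GChar.Lcd N).ncard := by
  have hbot : GChar.lowerGSeries N ((GChar.Lcd N).ncard + 1) = ⊥ := by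
    obtain ⟨s, f, hf⟩ := GChar.exists_enumeratesLcd N
    rw [← hf.eq_ncard, Subgroup.eq_bot_iff_forall]
    intro x hx
    refine congrArg Subtype.val (GChar.eq_one_of_forall_apply_eq
      (n := ⟨x, GChar.lowerGSeries_le N _ hx⟩) fun θ hθ => ?_)
    obtain ⟨d, -, hd⟩ := GChar.exists_nat_mul_hat_apply_one hθ
    obtain ⟨i, hi, rfl⟩ := hf.exists_index (d := d) ⟨θ, hθ, hd⟩
    exact hf.apply_eq_of_mem_lowerGSeries hN hi hθ hd (GChar.self_mem_conjOrbit θ)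
      (GChar.lowerGSeries_antitone N (Nat.succ_le_succ hi.2) hx)
  refine ⟨GChar.exists_enumeratesLcd N, fun s f hf => ⟨hf.eq_ncard, hf.apply_one.1,
    hf.apply_one.2, fun i hi θ hθ hd x hx => ?_⟩, ⟨_, Nat.succ_pos _, hbot⟩, Nat.sInf_le hbot⟩
  refine ⟨⟨x, GChar.lowerGSeries_le N _ hx⟩, ?_, rfl⟩
  simp only [GChar.charKer, Set.mem_ofPred_eq, GChar.hat, Finset.sum_apply]
  exact Finset.sum_congr rfl fun φ hφ => hf.apply_eq_of_mem_lowerGSeries hN hi hθ hd hφ hx
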